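/- Consider the $\lambda\bot$-calculus, with terms $M ::= x \mid \bot \mid \lambda x.M \mid MM$ (free variables are allowed) and reduction generated, in arbitrary contexts, by $(\lambda x.M)N \to M\{N/x\}$, $\bot M\to\bot$ and $\lambda x.\bot\to\bot$; write $M=N$ if $M$ and $N$ have a common reduct. Put $\mathbf I=\lambda x.x$, $\mathbf B=\lambda xyz.x(yz)$ and $M\circ N=\mathbf B MN$. A simple right inverse is a term $\lambda t x_1\ldots x_m.t$ with $m\ge 0$. Strict (intersection) types $\mu,\nu$ and intersections $\sigma,\tau$ are given by $\mu ::= \varphi \mid \omega \mid \sigma\to\mu$ and $\sigma ::= \mu \mid \sigma\wedge\sigma$, where $\varphi$ ranges over type variables and $\wedge$ is taken modulo idempotence, commutativity and associativity. Let $\le$ be the least reflexive and transitive relation on intersections such that $\sigma\le\omega$; $\omega\le\omega\to\omega$; $\sigma_1\wedge\sigma_2\le\sigma_i$ ($i=1,2$); $\sigma_1\le\tau_1$ and $\sigma_2\le\tau_2$ imply $\sigma_1\wedge\sigma_2\le\tau_1\wedge\tau_2$; $\sigma_2\le\sigma_1$ and $\mu_1\le\mu_2$ imply $\sigma_1\to\mu_1\le\sigma_2\to\mu_2$.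 Environments $\Gamma$ assign intersections to finitely many variables, and typing judgements are derived by the rules: $\Gamma,x:\bigwedge_{i\in I}\mu_i\vdash x:\mu_j$ for $j\in I$; $\Gamma\vdash M:\omega$; from $\Gamma\vdash M:\mu$ and $\mu\le\nu$ infer $\Gamma\vdash M:\nu$; from $\Gamma,x:\sigma\vdash M:\mu$ infer $\Gamma\vdash\lambda x.M:\sigma\to\mu$; from $\Gamma\vdash M:\bigwedge_{i\in I}\mu_i\to\mu$ and $\Gamma\vdash N:\mu_i$ for all $i\in I$ infer $\Gamma\vdash MN:\mu$. Terms $L,R$ witness the retraction $\mu\lhd\nu$ between strict types if $\vdash L:\nu\to\mu$, $\vdash R:\mu\to\nu$ and $L\circ R=\mathbf I$. **Theorem.** Let $L,R$ be terms such that $L\circ R=\mathbf I$ and $R$ is a simple right inverse. Then for every strict type $\mu$ there is a strict type $\nu$ such that $L,R$ witness the retraction $\mu\lhd\nu$. In particular, if $R=\lambda t x_1\ldots x_m.t$, then one can take $\nu=\underbrace{\omega\to\cdots\to\omega}_{m}\to\mu$. -/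

import Mathlib

namespace LambdaBot

/-! ### Terms of the lambda-bot-calculus (de Bruijn representation of terms modulo renaming) -/

/-- Terms `M ::= x | ⊥ | λx.M | M M`; the index `i` refers to the `i`-th enclosing abstraction,
and indices exceeding the number of enclosing abstractions are free variables. -/
inductive Tm : Type
  | var (i : ℕ) : Tm
  | bot : Tm
  | lam (M : Tm) : Tm
  | app (M N : Tm) : Tm

namespace Tm

/-- A renaming pushed under a binder. -/
def upRen (r : ℕ → ℕ) : ℕ → ℕ
  | 0 => 0
  | i + 1 => r i + 1

/-- Renaming of free variables. -/
def rename : (ℕ → ℕ) → Tm → Tm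
  | r, var i => var (r i)
  | _, bot => bot
  | r, lam M => lam (rename (upRen r) M)
  | r, app M N => app (rename r M) (rename r N)

/-- A substitution pushed under a binder. -/
def up (s : ℕ → Tm) : ℕ → Tm
  | 0 => var 0
  | i + 1 => rename Nat.succ (s i)

/-- Capture-avoiding parallel substitution. -/
def subst : (ℕ → Tm) → Tm → Tm
  | s, var i => s i
  | _, bot => bot
  | s, lam M => lam (subst (up s) M)
  | s, app M N => app (subst s M) (subst s N)

/-- The substitution `0 ↦ N`, `i + 1 ↦ var i`. -/
def single (N : Tm) : ℕ → Tm
  | 0 => N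
  | i + 1 => var i

/-- `M.inst N` is the contractum `M{N/x}` of the redex `(λx.M) N`. -/
def inst (M N : Tm) : Tm := subst (single N) M

/-- One-step reduction, in arbitrary contexts. -/
inductive Step : Tm → Tm → Prop
  | beta (M N : Tm) : Step (app (lam M) N) (M.inst N)
  | botApp (M : Tm) : Step (app bot M) bot
  | lamBot : Step (lam bot) bot
  | lam {M N : Tm} : Step M N → Step (lam M) (lam N)
  | appL {M N : Tm} (P : Tm) : Step M N → Step (app M P) (app N P)
  | appR (P : Tm) {M N : Tm} : Step M N → Step (app P M) (app P N)

/-- Many-step reduction. -/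
def Red : Tm → Tm → Prop := Relation.ReflTransGen Step

/-- Equality of terms: having a common reduct. -/
def Conv (M N : Tm) : Prop := ∃ P, Red M P ∧ Red N P

/-- `I = λx.x`. -/
def I : Tm := lam (var 0)

/-- `B = λxyz.x(yz)`. -/
def B : Tm := lam (lam (lam (app (var 2) (app (var 1) (var 0)))))

/-- `M ∘ N = B M N`. -/
def comp (M N : Tm) : Tm := app (app B M) N

/-- `λy₁…yₙ.M`. -/
def lams : ℕ → Tm → Tm
  | 0, M => M
  | n + 1, M => lam (lams n M)

/-- The term `λ t x₁ … xₘ . t`. -/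
def proj (m : ℕ) : Tm := lam (lams m (var m))

/-- Simple right inverses are the head normal forms `λ t x₁ … xₘ . t` with `m ≥ 0`. -/
def IsSimpleRightInverse (R : Tm) : Prop := ∃ m : ℕ, R = proj m

end Tm

/-! ### Strict intersection types -/

mutual
  /-- Strict types `μ ::= φ | ω | σ → μ`, with type variables `φ` indexed by `ℕ`. -/
  inductive STy : Type
    | var (a : ℕ) : STy
    | omega : STy
    | arrow (s : ITy) (m : STy) : STy
  /-- Intersections `σ ::= μ | σ ∧ σ`. Their identification modulo idempotence, commutativity and
  associativity is taken care of by the preorder `Le` below. -/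
  inductive ITy : Type
    | strict (m : STy) : ITy
    | inter (s t : ITy) : ITy
end

/-- `Component μ σ`: the strict type `μ` is one of the `μᵢ` when `σ` is written `⋀ᵢ μᵢ`. -/
inductive Component : STy → ITy → Prop
  | strict (m : STy) : Component m (ITy.strict m)
  | left {m : STy} {s : ITy} (t : ITy) : Component m s → Component m (ITy.inter s t)
  | right {m : STy} (s : ITy) {t : ITy} : Component m t → Component m (ITy.inter s t)

/-- The preorder on types and intersections. The rule `idem` accounts for intersections being
taken modulo idempotence; with it, commutativity and associativity follow from the other rules
(see `Sim.comm`, `Sim.assoc`). -/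
inductive Le : ITy → ITy → Prop
  | refl (s : ITy) : Le s s
  | trans {s t r : ITy} : Le s t → Le t r → Le s r
  | idem (s : ITy) : Le s (ITy.inter s s)
  | top (s : ITy) : Le s (ITy.strict STy.omega)
  | omegaArrow : Le (ITy.strict STy.omega)
      (ITy.strict (STy.arrow (ITy.strict STy.omega) STy.omega))
  | interLeft (s t : ITy) : Le (ITy.inter s t) s
  | interRight (s t : ITy) : Le (ITy.inter s t) t
  | inter {s₁ s₂ t₁ t₂ : ITy} : Le s₁ t₁ → Le s₂ t₂ → Le (ITy.inter s₁ s₂) (ITy.inter t₁ t₂)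
  | arrow {s₁ s₂ : ITy} {m₁ m₂ : STy} : Le s₂ s₁ → Le (ITy.strict m₁) (ITy.strict m₂) →
      Le (ITy.strict (STy.arrow s₁ m₁)) (ITy.strict (STy.arrow s₂ m₂))

/-- The equivalence induced by the preorder. -/
def Sim (s t : ITy) : Prop := Le s t ∧ Le t s

theorem Le.glb {s t r : ITy} (h₁ : Le r s) (h₂ : Le r t) : Le r (ITy.inter s t) :=
  (Le.idem r).trans (Le.inter h₁ h₂)

theorem Sim.idem (s : ITy) : Sim (ITy.inter s s) s :=
  ⟨Le.interLeft s s, Le.idem s⟩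

theorem Sim.comm (s t : ITy) : Sim (ITy.inter s t) (ITy.inter t s) :=
  ⟨Le.glb (Le.interRight s t) (Le.interLeft s t), Le.glb (Le.interRight t s) (Le.interLeft t s)⟩

theorem Sim.assoc (s t r : ITy) :
    Sim (ITy.inter (ITy.inter s t) r) (ITy.inter s (ITy.inter t r)) :=
  ⟨Le.glb ((Le.interLeft _ _).trans (Le.interLeft _ _))
      (Le.glb ((Le.interLeft _ _).trans (Le.interRight _ _)) (Le.interRight _ _)),
    Le.glb (Le.glb (Le.interLeft _ _) ((Le.interRight _ _).trans (Le.interLeft _ _)))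
      ((Le.interRight _ _).trans (Le.interRight _ _))⟩

/-! ### Type assignment -/

/-- Environments assign intersections to variables (given by their index); `none` means that the
variable is not declared. Every environment in a derivation that starts from the empty environment
declares only finitely many variables. -/
abbrev Env : Type := ℕ → Option ITy

/-- The empty environment. -/
def Env.empty : Env := fun _ => none

/-- `Γ, x : σ` for the variable `x` of a new innermost abstraction. -/
def Env.cons (s : ITy) (G : Env) : Env
  | 0 => some s
  | i + 1 => G i

/-- The essential intersection type assignment system. The second premise of `app` is the
judgement `Γ ⊢ N : σ` for an intersection `σ = ⋀ᵢ μᵢ`, i.e. `Γ ⊢ N : μᵢ` for all `i`. -/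
inductive Typing : Env → Tm → STy → Prop
  | ax {G : Env} {i : ℕ} {s : ITy} {m : STy} : G i = some s → Component m s →
      Typing G (Tm.var i) m
  | omega (G : Env) (M : Tm) : Typing G M STy.omega
  | sub {G : Env} {M : Tm} {m n : STy} : Typing G M m → Le (ITy.strict m) (ITy.strict n) →
      Typing G M n
  | lam {G : Env} {M : Tm} {s : ITy} {m : STy} : Typing (Env.cons s G) M m →
      Typing G (Tm.lam M) (STy.arrow s m)
  | app {G : Env} {M N : Tm} {s : ITy} {m : STy} : Typing G M (STy.arrow s m) →
      (∀ n : STy, Component n s → Typing G N n) → Typing G (Tm.app M N) m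

/-- The terms `L`, `R` witness the retraction `μ ◁ ν`. -/
def WitnessRetraction (L R : Tm) (m n : STy) : Prop :=
  Typing Env.empty L (STy.arrow (ITy.strict n) m) ∧
  Typing Env.empty R (STy.arrow (ITy.strict m) n) ∧
  Tm.Conv (Tm.comp L R) Tm.I

/-- `ω → … → ω → μ` with `k` occurrences of `ω` in front of `μ`. -/
def omegaArrows : ℕ → STy → STy
  | 0, m => m
  | k + 1, m => STy.arrow (ITy.strict STy.omega) (omegaArrows k m)

end LambdaBot

namespace LambdaBot

-- Typability is preserved by expansion. Since `I` is normal, `L ∘ R` reduces to `I`, so it inherits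
-- the type `μ → μ` (`Typing.red_expansion`). Inverting the typing of `B L R` yields an intersection
-- `r` with `L : r → μ` and `R : μ → n` for each component `n` of `r` (`Typing.comp_inv`). For `R =
-- λt x₁…xₘ.t` every such `n` lies above `ω → … → ω → μ` (`Typing.lams_var_inv`), and contravariance
-- lets `L` take that type as its domain. Expansion rests on `Typing.exists_total_of_subst`:
-- intersections collect the types at which a substituted term is used, and `ω` serves where it is
-- not used.

/-! ### Inversion of the preorder -/

/-- Inversion of the preorder at arrow components. -/
theorem Le.arrow_inv {s t : ITy} (h : Le s t) :
    ∀ {a : ITy} {b : STy}, Component (STy.arrow a b) t →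
      Le (ITy.strict STy.omega) (ITy.strict b) ∨
        ∃ c d, Component (STy.arrow c d) s ∧ Le a c ∧ Le (ITy.strict d) (ITy.strict b) := by
  induction h with
  | refl s => exact fun hc => Or.inr ⟨_, _, hc, Le.refl _, Le.refl _⟩
  | trans _ _ ih₁ ih₂ =>
    intro a b hc
    obtain h | ⟨c, d, hcd, hac, hdb⟩ := ih₂ hc
    · exact Or.inl h
    obtain h | ⟨c', d', hcd', hac', hdb'⟩ := ih₁ hcd
    · exact Or.inl (h.trans hdb)
    · exact Or.inr ⟨c', d', hcd', hac.trans hac', hdb'.trans hdb⟩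
  | idem s =>
    intro a b hc
    cases hc with
    | left _ hc => exact Or.inr ⟨_, _, hc, Le.refl _, Le.refl _⟩
    | right _ hc => exact Or.inr ⟨_, _, hc, Le.refl _, Le.refl _⟩
  | top s => intro a b hc; cases hc
  -- The only source of the first alternative: here an arrow lies above a type that has no arrow
  -- component.
  | omegaArrow => intro a b hc; cases hc; exact Or.inl (Le.refl _)
  | interLeft s t => exact fun hc => Or.inr ⟨_, _, hc.left _, Le.refl _, Le.refl _⟩
  | interRight s t => exact fun hc => Or.inr ⟨_, _, hc.right _, Le.refl _, Le.refl _⟩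
  | inter _ _ ih₁ ih₂ =>
    intro a b hc
    cases hc with
    | left _ hc =>
      exact (ih₁ hc).imp_right fun ⟨c, d, h, h'⟩ => ⟨c, d, h.left _, h'⟩
    | right _ hc =>
      exact (ih₂ hc).imp_right fun ⟨c, d, h, h'⟩ => ⟨c, d, h.right _, h'⟩
  | arrow h₁ h₂ =>
    intro a b hc
    cases hc
    exact Or.inr ⟨_, _, Component.strict _, h₁, h₂⟩

theorem Component.le {m : STy} {s : ITy} (h : Component m s) : Le s (ITy.strict m) := by
  induction h with
  | strict => exact Le.refl _
  | left t _ ih => exact (Le.interLeft _ _).trans ih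
  | right s _ ih => exact (Le.interRight _ _).trans ih

theorem Le.of_components {r s : ITy} (h : ∀ n, Component n s → Le r (ITy.strict n)) : Le r s := by
  -- `ITy` is mutual with `STy`, so its recursor also asks for a motive on strict types; a trivial
  -- one suffices.
  induction s using ITy.rec (motive_1 := fun _ => True) with
  | var => trivial
  | omega => trivial
  | arrow => trivial
  | strict m _ => exact h m (Component.strict m)
  | inter s t ih₁ ih₂ =>
    exact Le.glb (ih₁ fun n hn => h n (hn.left _)) (ih₂ fun n hn => h n (hn.right _))

/-! ### Typing with intersections -/

/-- The judgement `Γ ⊢ M : σ` for an intersection `σ`. -/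
def ITyping (G : Env) (M : Tm) (s : ITy) : Prop := ∀ n, Component n s → Typing G M n

theorem ITyping.strict {G : Env} {M : Tm} {m : STy} (h : Typing G M m) :
    ITyping G M (ITy.strict m) := fun _ hn => by cases hn; exact h

theorem ITyping.inter {G : Env} {M : Tm} {s t : ITy} (h₁ : ITyping G M s) (h₂ : ITyping G M t) :
    ITyping G M (ITy.inter s t) := fun n hn => by
  cases hn with
  | left _ h => exact h₁ n h
  | right _ h => exact h₂ n h

theorem ITyping.omega (G : Env) (M : Tm) : ITyping G M (ITy.strict STy.omega) :=
  ITyping.strict (Typing.omega G M)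

theorem ITyping.mono {G : Env} {M : Tm} {s t : ITy} (h : ITyping G M s) (hle : Le s t) :
    ITyping G M t := by
  induction hle with
  | refl => exact h
  | trans _ _ ih₁ ih₂ => exact ih₂ (ih₁ h)
  | idem => exact h.inter h
  | top => exact ITyping.omega G M
  | omegaArrow => exact ITyping.strict ((Typing.omega G M).sub Le.omegaArrow)
  | interLeft => exact fun n hn => h n (hn.left _)
  | interRight => exact fun n hn => h n (hn.right _)
  | inter _ _ ih₁ ih₂ =>
    exact (ih₁ fun n hn => h n (hn.left _)).inter (ih₂ fun n hn => h n (hn.right _))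
  | arrow h₁ h₂ => exact ITyping.strict ((h _ (Component.strict _)).sub (Le.arrow h₁ h₂))

theorem Typing.of_omega_le {m : STy} (h : Le (ITy.strict STy.omega) (ITy.strict m))
    (G : Env) (M : Tm) : Typing G M m :=
  (Typing.omega G M).sub h

theorem ITyping.var {G : Env} {i : ℕ} {s : ITy} (h : G i = some s) : ITyping G (Tm.var i) s :=
  fun _ hn => Typing.ax h hn

/-! ### Generation lemmas -/

theorem Typing.var_inv {G : Env} {i : ℕ} {m : STy} (h : Typing G (Tm.var i) m) :
    Le (ITy.strict STy.omega) (ITy.strict m) ∨ ∃ s, G i = some s ∧ Le s (ITy.strict m) := by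
  generalize hM : Tm.var i = M at h
  induction h with
  | ax hi hc => cases hM; exact Or.inr ⟨_, hi, hc.le⟩
  | omega => exact Or.inl (Le.refl _)
  | sub _ hle ih =>
    exact (ih hM).imp (fun h => h.trans hle) fun ⟨s, hs, h⟩ => ⟨s, hs, h.trans hle⟩
  | lam => cases hM
  | app => cases hM

theorem Typing.var_inv_some {G : Env} {i : ℕ} {s : ITy} {m : STy} (h : Typing G (Tm.var i) m)
    (hi : G i = some s) : Le s (ITy.strict m) := by
  obtain h | ⟨t, ht, h⟩ := h.var_inv
  · exact (Le.top s).trans h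
  · rw [hi] at ht
    cases ht
    exact h

theorem Typing.bot_inv {G : Env} {m : STy} (h : Typing G Tm.bot m) :
    Le (ITy.strict STy.omega) (ITy.strict m) := by
  generalize hM : Tm.bot = M at h
  induction h with
  | omega => exact Le.refl _
  | sub _ hle ih => exact (ih hM).trans hle
  | ax => cases hM
  | lam => cases hM
  | app => cases hM

theorem Typing.lam_inv {G : Env} {M : Tm} {m : STy} (h : Typing G (Tm.lam M) m) :
    Le (ITy.strict STy.omega) (ITy.strict m) ∨
      ∃ a b, Typing (Env.cons a G) M b ∧ Le (ITy.strict (STy.arrow a b)) (ITy.strict m) := by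
  generalize hM : Tm.lam M = M' at h
  induction h with
  | omega => exact Or.inl (Le.refl _)
  | sub _ hle ih =>
    exact (ih hM).imp (fun h => h.trans hle) fun ⟨a, b, h, h'⟩ => ⟨a, b, h, h'.trans hle⟩
  | lam h => cases hM; exact Or.inr ⟨_, _, h, Le.refl _⟩
  | ax => cases hM
  | app => cases hM

/-- No alternative for types above `ω` is needed: `ω ≤ ω → ω` types the function, with argument at
`ω`. Subsumption moves into the codomain of the arrow. -/
theorem Typing.app_inv {G : Env} {M N : Tm} {m : STy} (h : Typing G (Tm.app M N) m) :
    ∃ s, Typing G M (STy.arrow s m) ∧ ITyping G N s := by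
  generalize hM : Tm.app M N = M' at h
  induction h with
  | omega =>
    exact ⟨_, Typing.of_omega_le Le.omegaArrow _ _, ITyping.omega _ _⟩
  | sub _ hle ih =>
    obtain ⟨s, h₁, h₂⟩ := ih hM
    exact ⟨s, h₁.sub (Le.arrow (Le.refl _) hle), h₂⟩
  | app h₁ h₂ => cases hM; exact ⟨_, h₁, h₂⟩
  | lam => cases hM
  | ax => cases hM

/-! ### Renaming and change of environment -/

theorem Typing.rename {G : Env} {M : Tm} {m : STy} (h : Typing G M m) :
    ∀ {G' : Env} {r : ℕ → ℕ}, (∀ i t, G i = some t → G' (r i) = some t) →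
      Typing G' (M.rename r) m := by
  induction h with
  | ax hi hc => exact fun hr => Typing.ax (hr _ _ hi) hc
  | omega => exact fun _ => Typing.omega _ _
  | sub _ hle ih => exact fun hr => (ih hr).sub hle
  | lam _ ih =>
    intro G' r hr
    refine Typing.lam (ih ?_)
    rintro (_ | i) t hi
    · exact hi
    · exact hr i t hi
  | app _ _ ih₁ ih₂ => exact fun hr => Typing.app (ih₁ hr) fun n hn => ih₂ n hn hr

/-- Strengthening: entries of `G'` outside the range of `r` play no role. This removes the shift
that `up` inserts under a binder. -/
theorem Typing.of_rename {M : Tm} :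
    ∀ {G G' : Env} {r : ℕ → ℕ} {m : STy}, (∀ i, G' (r i) = G i) →
      Typing G' (M.rename r) m → Typing G M m := by
  induction M with
  | var i =>
    intro G G' r m hr h
    obtain h | ⟨s, hs, hle⟩ := Typing.var_inv h
    · exact Typing.of_omega_le h _ _
    · rw [hr] at hs
      exact (ITyping.var hs).mono hle _ (Component.strict _)
  | bot => exact fun _ h => Typing.of_omega_le h.bot_inv _ _
  | lam M ih =>
    intro G G' r m hr h
    obtain h | ⟨a, b, h, hle⟩ := Typing.lam_inv h
    · exact Typing.of_omega_le h _ _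
    · refine (Typing.lam (ih ?_ h)).sub hle
      rintro (_ | i)
      · rfl
      · exact hr i
  | app M N ih₁ ih₂ =>
    intro G G' r m hr h
    obtain ⟨s, h₁, h₂⟩ := Typing.app_inv h
    exact Typing.app (ih₁ hr h₁) fun n hn => ih₂ hr (h₂ n hn)

theorem ITyping.var_cons {G : Env} {i : ℕ} {t : ITy} (a : ITy) (h : ITyping G (Tm.var i) t) :
    ITyping (Env.cons a G) (Tm.var (i + 1)) t :=
  fun n hn => Typing.rename (r := Nat.succ) (h n hn) fun _ _ hi => hi

/-- Weakening and narrowing at once: a derivation uses its environment only through the types of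
variables. -/
theorem Typing.change_env {D : Env} {M : Tm} {m : STy} (h : Typing D M m) :
    ∀ {G : Env}, (∀ i t, D i = some t → ITyping G (Tm.var i) t) → Typing G M m := by
  induction h with
  | ax hi hc => exact fun hG => hG _ _ hi _ hc
  | omega => exact fun _ => Typing.omega _ _
  | sub _ hle ih => exact fun hG => (ih hG).sub hle
  | lam _ ih =>
    intro G hG
    refine Typing.lam (ih ?_)
    rintro (_ | i) t hi
    · exact ITyping.var hi
    · exact (hG i t hi).var_cons _
  | app _ _ ih₁ ih₂ => exact fun hG => Typing.app (ih₁ hG) fun n hn => ih₂ n hn hG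

/-- Subsumption may hide the arrow at which the abstraction was typed, but that arrow has a larger
domain and a smaller codomain, so narrowing the environment recovers the given one. -/
theorem Typing.lam_arrow_inv {G : Env} {M : Tm} {s : ITy} {m : STy}
    (h : Typing G (Tm.lam M) (STy.arrow s m)) : Typing (Env.cons s G) M m := by
  have key : Le (ITy.strict STy.omega) (ITy.strict m) ∨
      ∃ a b, Typing (Env.cons a G) M b ∧ Le s a ∧ Le (ITy.strict b) (ITy.strict m) := by
    obtain h | ⟨a, b, h, hle⟩ := h.lam_inv
    · obtain h | ⟨_, _, hc, _⟩ := h.arrow_inv (Component.strict _)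
      · exact Or.inl h
      · cases hc
    · obtain h' | ⟨_, _, hc, hs, hm⟩ := hle.arrow_inv (Component.strict _)
      · exact Or.inl h'
      · cases hc
        exact Or.inr ⟨a, b, h, hs, hm⟩
  obtain h | ⟨a, b, h, hs, hm⟩ := key
  · exact Typing.of_omega_le h _ _
  · refine (h.change_env ?_).sub hm
    rintro (_ | i) t hi
    · cases hi
      exact (ITyping.var rfl : ITyping (Env.cons s G) (Tm.var 0) s).mono hs
    · exact ITyping.var hi

/-! ### Subject expansion -/

/-- The environment declaring every variable. -/
def Env.total (D : ℕ → ITy) : Env := fun i => some (D i)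

theorem Typing.total_mono {D D' : ℕ → ITy} {M : Tm} {m : STy} (h : Typing (Env.total D) M m)
    (hle : ∀ i, Le (D' i) (D i)) : Typing (Env.total D') M m :=
  h.change_env fun i _ hi => by
    cases hi
    exact (ITyping.var rfl : ITyping (Env.total D') (Tm.var i) (D' i)).mono (hle i)

/-- Environments found for the components are merged by pointwise intersection, which only
strengthens the assumptions. -/
theorem ITyping.exists_total {G : Env} {M : Tm} {s : ℕ → Tm}
    (H : ∀ m, Typing G (M.subst s) m →
      ∃ D : ℕ → ITy, (∀ i, ITyping G (s i) (D i)) ∧ Typing (Env.total D) M m)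
    {t : ITy} (h : ITyping G (M.subst s) t) :
    ∃ D : ℕ → ITy, (∀ i, ITyping G (s i) (D i)) ∧ ITyping (Env.total D) M t := by
  induction t using ITy.rec (motive_1 := fun _ => True) with
  | var => trivial
  | omega => trivial
  | arrow => trivial
  | strict m _ =>
    obtain ⟨D, hD, hM⟩ := H m (h m (Component.strict m))
    exact ⟨D, hD, ITyping.strict hM⟩
  | inter t u ih₁ ih₂ =>
    obtain ⟨D₁, hD₁, hM₁⟩ := ih₁ fun n hn => h n (hn.left _)
    obtain ⟨D₂, hD₂, hM₂⟩ := ih₂ fun n hn => h n (hn.right _)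
    exact ⟨fun i => ITy.inter (D₁ i) (D₂ i), fun i => (hD₁ i).inter (hD₂ i),
      ITyping.inter (fun n hn => (hM₁ n hn).total_mono fun _ => Le.interLeft _ _)
        fun n hn => (hM₂ n hn).total_mono fun _ => Le.interRight _ _⟩

/-- A typing of `M{s}` factors through types for the terms substituted. -/
theorem Typing.exists_total_of_subst {M : Tm} :
    ∀ {G : Env} {s : ℕ → Tm} {m : STy}, Typing G (M.subst s) m →
      ∃ D : ℕ → ITy, (∀ i, ITyping G (s i) (D i)) ∧ Typing (Env.total D) M m := by
  induction M with
  | var i =>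
    intro G s m h
    refine ⟨fun j => if j = i then ITy.strict m else ITy.strict STy.omega, fun j => ?_,
      Typing.ax (s := ITy.strict m) (by simp [Env.total]) (Component.strict m)⟩
    by_cases hj : j = i
    · subst hj
      simp only [if_true]
      exact ITyping.strict h
    · simpa [hj] using ITyping.omega G (s j)
  | bot =>
    exact fun h => ⟨fun _ => ITy.strict STy.omega, fun _ => ITyping.omega _ _,
      Typing.of_omega_le h.bot_inv _ _⟩
  | lam M ih =>
    intro G s m h
    obtain h | ⟨a, b, h, hle⟩ := Typing.lam_inv h
    · exact ⟨fun _ => ITy.strict STy.omega, fun _ => ITyping.omega _ _,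
        Typing.of_omega_le h _ _⟩
    obtain ⟨D, hD, hM⟩ := ih h
    refine ⟨fun i => D (i + 1), fun i n hn => ?_, (Typing.lam (hM.change_env ?_)).sub hle⟩
    · exact Typing.of_rename (r := Nat.succ) (fun _ => rfl) (hD (i + 1) n hn)
    · rintro (_ | i) t hi
      · cases hi
        intro n hn
        -- `up s` fixes the bound variable, so whatever `D 0` demands of it already follows from
        -- `a`.
        have : Le a (ITy.strict n) := Typing.var_inv_some (hD 0 n hn) rfl
        exact (ITyping.var rfl : ITyping (Env.cons a _) (Tm.var 0) a).mono this _
          (Component.strict n)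
      · exact ITyping.var hi
  | app M N ih₁ ih₂ =>
    intro G s m h
    obtain ⟨t, h₁, h₂⟩ := Typing.app_inv h
    obtain ⟨D₁, hD₁, hM⟩ := ih₁ h₁
    obtain ⟨D₂, hD₂, hN⟩ := ITyping.exists_total (fun _ => ih₂) h₂
    exact ⟨fun i => ITy.inter (D₁ i) (D₂ i), fun i => (hD₁ i).inter (hD₂ i),
      Typing.app (hM.total_mono fun _ => Le.interLeft _ _)
        fun n hn => (hN n hn).total_mono fun _ => Le.interRight _ _⟩

/-- `D 0` becomes the domain of the abstraction; the other `D (i + 1)` are types of `var i` in `G`,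
because `single N` only shifts those variables down. -/
theorem Typing.beta_expansion {G : Env} {M N : Tm} {m : STy} (h : Typing G (M.inst N) m) :
    Typing G (Tm.app (Tm.lam M) N) m := by
  obtain ⟨D, hD, hM⟩ := Typing.exists_total_of_subst h
  refine Typing.app (s := D 0) (Typing.lam (hM.change_env ?_)) (hD 0)
  rintro (_ | i) t hi
  · exact ITyping.var hi
  · cases hi
    exact (hD (i + 1)).var_cons _

theorem Typing.step_expansion {M N : Tm} (hMN : Tm.Step M N) :
    ∀ {G : Env} {m : STy}, Typing G N m → Typing G M m := by
  induction hMN with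
  | beta => exact Typing.beta_expansion
  -- The contractum `⊥` has only types above `ω`, and these belong to every term.
  | botApp => exact fun h => Typing.of_omega_le h.bot_inv _ _
  | lamBot => exact fun h => Typing.of_omega_le h.bot_inv _ _
  | lam _ ih =>
    intro G m h
    obtain h | ⟨a, b, h, hle⟩ := Typing.lam_inv h
    · exact Typing.of_omega_le h _ _
    · exact (Typing.lam (ih h)).sub hle
  | appL _ _ ih =>
    intro G m h
    obtain ⟨s, h₁, h₂⟩ := Typing.app_inv h
    exact Typing.app (ih h₁) h₂
  | appR _ _ ih =>
    intro G m h
    obtain ⟨s, h₁, h₂⟩ := Typing.app_inv h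
    exact Typing.app h₁ fun n hn => ih (h₂ n hn)

theorem Typing.red_expansion {M N : Tm} (hMN : Tm.Red M N) {G : Env} {m : STy}
    (h : Typing G N m) : Typing G M m := by
  induction hMN with
  | refl => exact h
  | tail _ hs ih => exact ih (Typing.step_expansion hs h)

theorem Tm.Red.eq_of_I {P : Tm} (h : Tm.Red Tm.I P) : P = Tm.I := by
  induction h with
  | refl => rfl
  | tail _ hs ih =>
    subst ih
    cases hs with
    | lam hs => cases hs

/-! ### Retractions with simple right inverses -/

theorem Typing.lams_var {m : ℕ} {μ : STy} :
    ∀ {G : Env} {i : ℕ}, G i = some (ITy.strict μ) →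
      Typing G (Tm.lams m (Tm.var (i + m))) (omegaArrows m μ) := by
  induction m with
  | zero => exact fun hi => Typing.ax hi (Component.strict μ)
  | succ m ih =>
    intro G i hi
    have : i + (m + 1) = i + 1 + m := by omega
    rw [this]
    exact Typing.lam (ih (i := i + 1) hi)

/-- `ω → … → ω → μ` is the least type of `λx₁…xₘ.t` when `t : μ`. -/
theorem Typing.lams_var_inv {m : ℕ} {μ : STy} :
    ∀ {G : Env} {i : ℕ} {n : STy}, G i = some (ITy.strict μ) →
      Typing G (Tm.lams m (Tm.var (i + m))) n →
        Le (ITy.strict (omegaArrows m μ)) (ITy.strict n) := by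
  induction m with
  | zero => exact fun hi h => Typing.var_inv_some h hi
  | succ m ih =>
    intro G i n hi h
    have : i + (m + 1) = i + 1 + m := by omega
    rw [this] at h
    obtain h | ⟨a, b, h, hle⟩ := Typing.lam_inv h
    · exact (Le.top _).trans h
    · exact (Le.arrow (Le.top a) (ih (i := i + 1) hi h)).trans hle

theorem Typing.proj (m : ℕ) (μ : STy) (G : Env) :
    Typing G (Tm.proj m) (STy.arrow (ITy.strict μ) (omegaArrows m μ)) := by
  have := Typing.lams_var (m := m) (G := Env.cons (ITy.strict μ) G) (i := 0) rfl
  rw [Nat.zero_add] at this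
  exact Typing.lam this

/-- Inversion of typings of compositions. -/
theorem Typing.comp_inv {G : Env} {L R : Tm} {s : ITy} {m : STy}
    (h : Typing G (Tm.comp L R) (STy.arrow s m)) :
    ∃ r, Typing G L (STy.arrow r m) ∧
      ∀ n, Component n r → Typing G R (STy.arrow s n) := by
  obtain ⟨t, h, hR⟩ := h.app_inv
  obtain ⟨u, h, hL⟩ := h.app_inv
  obtain ⟨r, hx, hyz⟩ := h.lam_arrow_inv.lam_arrow_inv.lam_arrow_inv.app_inv
  refine ⟨r, hL.mono (hx.var_inv_some rfl) _ (Component.strict _), fun n hn => ?_⟩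
  obtain ⟨p, hy, hz⟩ := (hyz n hn).app_inv
  -- The argument of `R` in the body of `B` is the bound variable of type `s`, so the domain `p`
  -- required by `R` can be narrowed to `s`.
  have hp : Le s p := Le.of_components fun n hn => (hz n hn).var_inv_some rfl
  exact (hR.mono (hy.var_inv_some rfl) _ (Component.strict _)).sub (Le.arrow hp (Le.refl _))

theorem Typing.left_inverse_of_proj {L : Tm} {m : ℕ}
    (hLR : Tm.Conv (Tm.comp L (Tm.proj m)) Tm.I) (μ : STy) (G : Env) :
    Typing G L (STy.arrow (ITy.strict (omegaArrows m μ)) μ) := by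
  obtain ⟨P, hP, hI⟩ := hLR
  rw [hI.eq_of_I] at hP
  have hid : Typing G Tm.I (STy.arrow (ITy.strict μ) μ) :=
    Typing.lam (Typing.ax rfl (Component.strict μ))
  obtain ⟨r, hL, hR⟩ := (Typing.red_expansion hP hid).comp_inv
  -- By contravariance it is enough that `omegaArrows m μ` lies below each component of `r`.
  refine hL.sub (Le.arrow (Le.of_components fun n hn => ?_) (Le.refl _))
  have h := (hR n hn).lam_arrow_inv
  exact Typing.lams_var_inv (i := 0) rfl (by rwa [Nat.zero_add])

theorem witnessRetraction_proj {L : Tm} {m : ℕ}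
    (hLR : Tm.Conv (Tm.comp L (Tm.proj m)) Tm.I) (μ : STy) :
    WitnessRetraction L (Tm.proj m) μ (omegaArrows m μ) :=
  ⟨Typing.left_inverse_of_proj hLR μ _, Typing.proj m μ _, hLR⟩

end LambdaBot

theorem mainTheorem9 (L R : LambdaBot.Tm)
    (hLR : LambdaBot.Tm.Conv (LambdaBot.Tm.comp L R) LambdaBot.Tm.I)
    (hR : LambdaBot.Tm.IsSimpleRightInverse R) (μ : LambdaBot.STy) :
    (∃ ν : LambdaBot.STy, LambdaBot.WitnessRetraction L R μ ν) ∧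
      ∀ m : ℕ, R = LambdaBot.Tm.proj m →
        LambdaBot.WitnessRetraction L R μ (LambdaBot.omegaArrows m μ) := by
  have key : ∀ m : ℕ, R = LambdaBot.Tm.proj m →
      LambdaBot.WitnessRetraction L R μ (LambdaBot.omegaArrows m μ) := by
    rintro m rfl
    exact LambdaBot.witnessRetraction_proj hLR μ
  obtain ⟨m, hm⟩ := hR
  exact ⟨⟨_, key m hm⟩, key⟩
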